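/- **Setting.** A cell is crossed by $n$ line segments; a mobile user entering along line $k$ stays in the cell for $l_k\ge 1$ slots. In slot $\tau$, $A_{k,\tau}$ users enter along line $k$; the arrival vectors $(A_{1,\tau},\dots,A_{n,\tau})$ are bounded and i.i.d. over $\tau$. The state $s(\tau)$ is the finite multiset of pairs (line $z_i$, residual sojourn time $t_i\in\{1,\dots,l_{z_i}\}$) of the mobile users present at the beginning of slot $\tau$: during a slot every residual time decreases by one, users whose residual time becomes $0$ leave, and a user entering along line $k$ is added with residual time $l_k$. The initial state is arbitrary. "Every state" below means every state of positive steady-state probability, i.e. with $g(s)>0$ for a stationary distribution $g$ of this Markov chain. **Fading.** For every link (a pair of a base station and a location; there may be infinitely many) let $h_\tau(b)$ be the fading gain of link $b$ in slot $\tau$. The gains take values in a bounded set $S\subset[0,\infty)$ and the family of fading processes is independent of the arrivals. For each finite set $F$ of links, $(h_\tau(b))_{b\in F}$ is a time-homogeneous Markov process over the slots $\tau$ that is ergodic in the following sense: its law after $m$ steps converges in total variation, as $m\to\infty$, uniformly in the initial point, to a probability measure $\pi_F$; here $\pi_F$ is the marginal of a probability measure $\pi$ on the gains of all links (the fading distribution).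 The initial distribution of the gains is arbitrary. **Rates.** In state $s$, the mobile (static) users would together download, per unit bandwidth, $R_{mobile}(s)=r_{mobile}(s,h_\tau)$ (respectively $R_{static}(s)=r_{static}(s,h_\tau)$) in slot $\tau$, where $r_{mobile}(s,\cdot)$ and $r_{static}(s,\cdot)$ are nonnegative functions of the gains which are bounded when the gains are bounded and which, for bounded gains, are uniform limits of measurable functions of finitely many gains (with finitely many links: measurable functions). For $\alpha\in(0,1)$ put $\overline R_{mobile}^{\alpha}(s)=\int r_{mobile}(s,h)^\alpha\,\pi(dh)$ and $\overline R_{static}^{\alpha}(s)=\int r_{static}(s,h)^\alpha\,\pi(dh)$. **Algorithm.** Let $\xi>0$ and let $(a(t))_{t\ge1}$ be a decreasing sequence of positive numbers with $\sum_t a(t)=\infty$ and $\sum_t a(t)^2<\infty$. Start with arbitrary estimates $R_{mobile,\alpha}^{(0)}(s)>0$, $R_{static,\alpha}^{(0)}(s)>0$. Number the slots $\tau=0,1,2,\dots$. In slot $\tau$, in state $s=s(\tau)$, allocate to the mobile users the fraction $$\eta_\tau=\frac{(\xi R_{static,\alpha}^{(\tau)}(s))^{\frac1{\alpha-1}}}{(\xi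 R_{static,\alpha}^{(\tau)}(s))^{\frac1{\alpha-1}}+(R_{mobile,\alpha}^{(\tau)}(s))^{\frac1{\alpha-1}}}$$ of the bandwidth, and then, for every state $s$, with $\nu(s,\tau)=\#\{t\le\tau: s(t)=s\}$ and with the samples $r_{mobile}(s(\tau),h_\tau)^\alpha$ and $r_{static}(s(\tau),h_\tau)^\alpha$ obtained in slot $\tau$, update $$R_{mobile,\alpha}^{(\tau+1)}(s)=R_{mobile,\alpha}^{(\tau)}(s)+a(\nu(s,\tau))\mathbf 1\{s(\tau)=s\}\bigl(r_{mobile}(s,h_\tau)^\alpha-R_{mobile,\alpha}^{(\tau)}(s)\bigr),$$ $$R_{static,\alpha}^{(\tau+1)}(s)=R_{static,\alpha}^{(\tau)}(s)+a(\nu(s,\tau))\mathbf 1\{s(\tau)=s\}\bigl(r_{static}(s,h_\tau)^\alpha-R_{static,\alpha}^{(\tau)}(s)\bigr).$$ **Theorem.** For every state $s$, almost surely, $$\lim_{\tau\to\infty}R_{mobile,\alpha}^{(\tau)}(s)=\overline R_{mobile}^{\alpha}(s)\qquad\text{and}\qquad \lim_{\tau\to\infty}R_{static,\alpha}^{(\tau)}(s)=\overline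 R_{static}^{\alpha}(s).$$ -/

import Mathlib

open MeasureTheory ProbabilityTheory Filter Topology

namespace AlphaFair

/-! ### The state of the cell -/

/-- A mobile user present in a cell crossed by `n` line segments, where a user stays for `l k` slots on
the `k`-th one: the line along which it moves and its residual sojourn time, in `{1, …, l k}`. -/
structure MobileUser {n : ℕ} (l : Fin n → ℕ+) where
  line : Fin n
  residual : ℕ
  residual_pos : 0 < residual
  residual_le : residual ≤ (l line : ℕ)

/-- The state of the cell at the beginning of a slot: the finite collection of mobile users present. -/
abbrev CellState {n : ℕ} (l : Fin n → ℕ+) : Type := Multiset (MobileUser l)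

variable {n : ℕ} {l : Fin n → ℕ+}

/-- One slot elapses for a user: the residual sojourn time drops by one, and the user leaves the cell
(value `none`) when it reaches zero. -/
def MobileUser.age (u : MobileUser l) : Option (MobileUser l) :=
  if h : 1 < u.residual then
    some ⟨u.line, u.residual - 1, Nat.sub_pos_of_lt h, (Nat.sub_le _ _).trans u.residual_le⟩
  else none

/-- A user that has just entered the cell along line `k`. -/
def MobileUser.entering (l : Fin n → ℕ+) (k : Fin n) : MobileUser l :=
  ⟨k, l k, (l k).pos, le_rfl⟩

/-- The next state, when `A k` users enter along line `k` during the slot. -/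
def CellState.next (s : CellState l) (A : Fin n → ℕ) : CellState l :=
  s.filterMap MobileUser.age + ∑ k, Multiset.replicate (A k) (MobileUser.entering l k)

/-- `g` is a steady-state (stationary) distribution of the state process driven by i.i.d. arrivals that
are distributed like the random vector `A`. -/
def IsSteadyState {Ω : Type*} [MeasurableSpace Ω] (P : Measure Ω) (A : Ω → Fin n → ℕ)
    (g : PMF (CellState l)) : Prop :=
  ∀ s' : CellState l, g s' = ∑' s : CellState l, g s * P {ω | s.next (A ω) = s'}

/-! ### Fading -/

/-- `X` is a time-homogeneous Markov process with transition kernel `κ`, with respect to its own past. -/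
def IsMarkovProcess {Ω E : Type*} [MeasurableSpace Ω] [MeasurableSpace E] (P : Measure Ω)
    (X : ℕ → Ω → E) (κ : Kernel E E) : Prop :=
  ∀ (k : ℕ) (B : Set E), MeasurableSet B →
    P[(X (k + 1) ⁻¹' B).indicator (fun _ => (1 : ℝ)) |
        ⨆ i ≤ k, MeasurableSpace.comap (X i) inferInstance]
      =ᵐ[P] fun ω => (κ (X k ω)).real B

/-- The Markov kernel `κ` is (uniformly) ergodic with limit `π`: whatever the initial point, the law
after `m` steps converges to `π` in total variation, uniformly in the initial point. -/
def IsErgodicKernel {E : Type*} [MeasurableSpace E] (κ : Kernel E E) (π : Measure E) : Prop :=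
  ∀ ε : ℝ, 0 < ε → ∃ N : ℕ, ∀ m : ℕ, N ≤ m → ∀ (x : E) (B : Set E), MeasurableSet B →
    |((κ ^ m) x).real B - π.real B| ≤ ε

/-- The fading assumption. `G k ω b` is the fading gain of link `b` (a pair of a base station and a
location) in slot `k`; gains lie in `S`. The gains of any finite set of links form an ergodic Markov
process across slots, and `π` is the limiting joint law of the gains of all links. -/
structure IsErgodicFading {Ω Link : Type*} [MeasurableSpace Ω] (P : Measure Ω) (S : Set ℝ)
    (G : ℕ → Ω → Link → S) (π : Measure (Link → S)) : Prop where
  nonneg : ∀ x ∈ S, 0 ≤ x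
  bounded : Bornology.IsBounded S
  measurable : ∀ k, Measurable (G k)
  ergodic : ∀ F : Finset Link, ∃ κ : Kernel (F → S) (F → S), IsMarkovKernel κ ∧
    IsMarkovProcess P (fun k ω (b : F) => G k ω b) κ ∧
    IsErgodicKernel κ (π.map fun x (b : F) => x b)

/-- A rate (data volume per slot and per unit bandwidth) as a function of the gains of all links: it is
nonnegative, bounded as long as the gains are bounded, and, for bounded gains, a uniform limit of
measurable functions of finitely many gains. If there are finitely many links, the last requirement just
says that the rate is measurable in the gains. -/
structure IsRateFunction {Link : Type*} (r : (Link → ℝ) → ℝ) : Prop where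
  nonneg : ∀ h : Link → ℝ, (∀ b, 0 ≤ h b) → 0 ≤ r h
  bounded : ∀ c : ℝ, ∃ C : ℝ, ∀ h : Link → ℝ, (∀ b, 0 ≤ h b ∧ h b ≤ c) → r h ≤ C
  approx : ∀ c ε : ℝ, 0 < ε → ∃ (F : Finset Link) (q : (F → ℝ) → ℝ), Measurable q ∧
    ∀ h : Link → ℝ, (∀ b, 0 ≤ h b ∧ h b ≤ c) → |r h - q (fun b : F => h b)| ≤ ε

/-- The `α`-th moment of the rate `r` under the fading law `π`. -/
noncomputable def rateMoment {Link : Type*} {S : Set ℝ} (π : Measure (Link → S)) (α : ℝ)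
    (r : (Link → ℝ) → ℝ) : ℝ :=
  ∫ x, (r fun b => (x b : ℝ)) ^ α ∂π

/-! ### The learning algorithm -/

/-- The fraction of bandwidth given to the mobile users when the `α`-th moments of the mobile and static
rates are (believed to be) `m` and `q`. -/
noncomputable def fairFraction (α ξ m q : ℝ) : ℝ :=
  (ξ * q) ^ (1 / (α - 1)) / ((ξ * q) ^ (1 / (α - 1)) + m ^ (1 / (α - 1)))

open Classical in
/-- The number of visits of the path `s` to the state `x` up to and including slot `k`. -/
noncomputable def visits {X : Type*} (s : ℕ → X) (x : X) (k : ℕ) : ℕ :=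
  ((Finset.range (k + 1)).filter fun i => s i = x).card

open Classical in
/-- A run of the learning algorithm along a path `s` of states, with step sizes `a`. Slots are numbered
`0, 1, 2, …`, so that `M k x` and `Q k x` are the estimates for state `x` held at the decision instant of
slot `k`, the initial ones being `M 0` and `Q 0`. `η k` is the fraction of bandwidth given to the mobile
users in slot `k`; `sampleM k` and `sampleQ k` are the samples of the `α`-th powers of the mobile and of
the static rate per unit bandwidth obtained in slot `k`. -/
structure IsRun {X : Type*} (α ξ : ℝ) (a : ℕ → ℝ) (s : ℕ → X) (sampleM sampleQ : ℕ → ℝ)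
    (M Q : ℕ → X → ℝ) (η : ℕ → ℝ) : Prop where
  initM : ∀ x, 0 < M 0 x
  initQ : ∀ x, 0 < Q 0 x
  allocation : ∀ k, η k = fairFraction α ξ (M k (s k)) (Q k (s k))
  updateM : ∀ k x, M (k + 1) x =
    M k x + a (visits s x k) * (if s k = x then 1 else 0) * (sampleM k - M k x)
  updateQ : ∀ k x, Q (k + 1) x =
    Q k x + a (visits s x k) * (if s k = x then 1 else 0) * (sampleQ k - Q k x)

end AlphaFair

/-!
Fix a state `x` of positive steady-state probability. Its estimate follows the recursion
`y (k + 1) = y k + b k * (f (G k) - y k)`, where `f` is the `α`-th power of the rate in state `x` and `b k`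
is the step size of the current visit if the state in slot `k` is `x`, and zero otherwise.

The path of states is a function of the initial state, which takes countably many values, and of the
arrivals, which are independent of the fading. By Fubini's theorem the path can therefore be frozen, and
the step sizes `b` become deterministic (`ae_tendsto_recursiveAverage_statePath`). They are square
summable. They have an infinite sum because `x` is visited infinitely often
(`ae_frequently_statePath_eq`): the cell forgets its initial state after as many slots as the longest line
has, stationarity yields a sequence of arrivals of positive probability leading to `x`, and by the second
Borel-Cantelli lemma this sequence occurs infinitely often.

For deterministic step sizes, approximate `f` uniformly by a function `p` of finitely many gains, which
form a uniformly ergodic Markov process. The prediction of `p` from the past `m` slots earlier is close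
to its mean when `m` is large, and the difference between `p` and this prediction is a sum of `m`
martingale differences, each of which gives an almost surely convergent series with the weights `b`
(`ae_exists_tendsto_sum_martingaleDifference`, `IsMarkovProcess.ae_exists_noise`). The recursion thus
sees its target up to a noise whose weighted series converges and an arbitrarily small error, and so it
converges (`tendsto_of_recursion`).
-/

namespace AlphaFair

variable {n : ℕ} {l : Fin n → ℕ+}

/-! ### Stochastic approximation with deterministic noise -/

/-- A contraction with divergent total step size forgets its initial value: this is
`∏ (1 - b i) ≤ exp (-∑ b i) → 0`. -/
lemma eventually_le_of_contraction {b u : ℕ → ℝ} {N : ℕ} (hb0 : ∀ k, 0 ≤ b k)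
    (hbsum : ¬ Summable b) (hb1 : ∀ k, N ≤ k → b k ≤ 1)
    (hu : ∀ k, N ≤ k → u (k + 1) ≤ (1 - b k) * u k) {ε : ℝ} (hε : 0 < ε) :
    ∀ᶠ k in atTop, u k ≤ ε := by
  set w : ℕ → ℝ := fun k => ∑ i ∈ Finset.range k, b i
  have hw : Tendsto w atTop atTop := (not_summable_iff_tendsto_nat_atTop_of_nonneg hb0).1 hbsum
  have key : ∀ k, N ≤ k → u k ≤ max (u N) 0 * Real.exp (w N - w k) := by
    intro k hk
    induction k, hk using Nat.le_induction with
    | base => simp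
    | succ k hk ih =>
      have h1 : 1 - b k ≤ Real.exp (-b k) := by linarith [Real.add_one_le_exp (-b k)]
      have h2 : w (k + 1) = w k + b k := Finset.sum_range_succ _ _
      calc u (k + 1) ≤ (1 - b k) * u k := hu k hk
        _ ≤ (1 - b k) * (max (u N) 0 * Real.exp (w N - w k)) :=
          mul_le_mul_of_nonneg_left ih (by linarith [hb1 k hk])
        _ ≤ Real.exp (-b k) * (max (u N) 0 * Real.exp (w N - w k)) :=
          mul_le_mul_of_nonneg_right h1 (by positivity)
        _ = max (u N) 0 * Real.exp (w N - w (k + 1)) := by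
          rw [h2, show w N - (w k + b k) = -b k + (w N - w k) by ring, Real.exp_add]; ring
  have hlim : Tendsto (fun k => max (u N) 0 * Real.exp (w N - w k)) atTop (𝓝 0) := by
    have hexp : Tendsto (fun k => Real.exp (w N - w k)) atTop (𝓝 0) :=
      Real.tendsto_exp_atBot.comp
        (tendsto_atBot_add_const_left _ (w N) (tendsto_neg_atTop_atBot.comp hw))
    simpa using hexp.const_mul (max (u N) 0)
  filter_upwards [hlim.eventually_le_const hε, eventually_ge_atTop N] with k h1 h2
  exact (key k h2).trans h1

/-- Convergence of a stochastic approximation recursion whose samples are, up to an arbitrarily small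
error, the target `c` plus a noise `d` for which the weighted series converges. -/
lemma tendsto_of_recursion {b y f : ℕ → ℝ} {c : ℝ} (hb0 : ∀ k, 0 ≤ b k)
    (hbsum : ¬ Summable b) (hblim : Tendsto b atTop (𝓝 0))
    (hy : ∀ k, y (k + 1) = y k + b k * (f k - y k))
    (hf : ∀ ε : ℝ, 0 < ε → ∃ d : ℕ → ℝ,
      (∃ σ, Tendsto (fun k => ∑ i ∈ Finset.range k, b i * d i) atTop (𝓝 σ)) ∧
        ∀ᶠ k in atTop, |f k - c - d k| ≤ ε) :
    Tendsto y atTop (𝓝 c) := by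
  rw [Metric.tendsto_atTop']
  intro ε hε
  obtain ⟨d, ⟨σ, hσ⟩, hd⟩ := hf (ε / 8) (by positivity)
  set w : ℕ → ℝ := fun k => ∑ i ∈ Finset.range k, b i * d i
  have hwσ : ∀ᶠ k in atTop, |w k - σ| ≤ ε / 8 := by
    have := (tendsto_iff_norm_sub_tendsto_zero.1 hσ).eventually_le_const
      (show (0 : ℝ) < ε / 8 by positivity)
    simpa [Real.norm_eq_abs] using this
  obtain ⟨N, hN⟩ := eventually_atTop.1
    ((hblim.eventually_le_const one_pos).and (hwσ.and hd))
  -- Subtracting the tail of the noise series from the error turns the noise into a small one.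
  set z : ℕ → ℝ := fun k => y k - c - (w k - σ)
  have hz : ∀ k, N ≤ k → |z (k + 1)| - ε / 4 ≤ (1 - b k) * (|z k| - ε / 4) := by
    intro k hk
    obtain ⟨h1, h2, h3⟩ := hN k hk
    have e : z (k + 1) = (1 - b k) * z k + b k * ((f k - c - d k) - (w k - σ)) := by
      simp only [z, hy, w, Finset.sum_range_succ]; ring
    have h4 : |(f k - c - d k) - (w k - σ)| ≤ ε / 4 := by
      linarith [abs_sub (f k - c - d k) (w k - σ)]
    have h5 : |z (k + 1)| ≤ (1 - b k) * |z k| + b k * (ε / 4) := by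
      rw [e]
      refine (abs_add_le _ _).trans ?_
      rw [abs_mul, abs_mul, abs_of_nonneg (hb0 k), abs_of_nonneg (sub_nonneg.2 h1)]
      gcongr
      exact hb0 k
    linarith
  obtain ⟨K, hK⟩ := eventually_atTop.1 (eventually_le_of_contraction
    (u := fun k => |z k| - ε / 4) hb0 hbsum
    (fun k hk => (hN k hk).1) hz (show (0 : ℝ) < ε / 4 by positivity))
  refine ⟨max K N, fun k hk => ?_⟩
  have h1 := hK k (by omega)
  have h2 := (hN k (by omega)).2.1
  have e : y k - c = z k + (w k - σ) := by simp only [z]; ring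
  rw [Real.dist_eq, e]
  linarith [abs_add_le (z k) (w k - σ)]

/-! ### Step sizes along the visits to a state -/

open Classical in
/-- The step size used in slot `k` for the state `x` along the path `s`: it is zero when `x` is not the
current state. -/
noncomputable def stepWeight {X : Type*} (a : ℕ → ℝ) (s : ℕ → X) (x : X) (k : ℕ) : ℝ :=
  a (visits s x k) * (if s k = x then 1 else 0)

open Classical in
/-- Summing along the visits to `x` is the same as summing over the number of the visit. -/
lemma sum_visits {X : Type*} (φ : ℕ → ℝ) (s : ℕ → X) (x : X) (k : ℕ) :
    ∑ i ∈ Finset.range k, (if s i = x then φ (visits s x i) else 0) =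
      ∑ j ∈ Finset.range ((Finset.range k).filter fun i => s i = x).card, φ (j + 1) := by
  induction k with
  | zero => simp
  | succ k ih =>
    rw [Finset.sum_range_succ, ih]
    by_cases h : s k = x
    · have hcard : ((Finset.range (k + 1)).filter fun i => s i = x).card =
          ((Finset.range k).filter fun i => s i = x).card + 1 := by
        simp [Finset.range_add_one, Finset.filter_insert, h]
      rw [hcard, Finset.sum_range_succ, if_pos h, visits, hcard]
    · simp [Finset.range_add_one, Finset.filter_insert, h]

lemma stepWeight_nonneg {X : Type*} {a : ℕ → ℝ} (ha : ∀ t, 1 ≤ t → 0 < a t) (s : ℕ → X) (x : X)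
    (k : ℕ) : 0 ≤ stepWeight a s x k := by
  classical
  unfold stepWeight
  split_ifs with h
  · have : 1 ≤ visits s x k := Finset.card_pos.2 ⟨k, by simp [h]⟩
    simpa using (ha _ this).le
  · simp

lemma summable_stepWeight_sq {X : Type*} {a : ℕ → ℝ} (ha : Summable fun t : ℕ => a (t + 1) ^ 2)
    (s : ℕ → X) (x : X) : Summable fun k => stepWeight a s x k ^ 2 := by
  classical
  refine summable_of_sum_range_le (c := ∑' t : ℕ, a (t + 1) ^ 2) (fun _ => sq_nonneg _) fun k => ?_
  have e : ∀ i, stepWeight a s x i ^ 2 = if s i = x then (fun t => a t ^ 2) (visits s x i) else 0 := by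
    intro i; unfold stepWeight; split_ifs <;> simp
  simp_rw [e]
  rw [sum_visits (fun t => a t ^ 2)]
  exact ha.sum_le_tsum _ fun _ _ => sq_nonneg _

lemma not_summable_stepWeight {X : Type*} {a : ℕ → ℝ} (ha : ∀ t, 1 ≤ t → 0 < a t)
    (hsum : ¬ Summable fun t : ℕ => a (t + 1)) {s : ℕ → X} {x : X}
    (hx : ∃ᶠ k in atTop, s k = x) : ¬ Summable (stepWeight a s x) := by
  classical
  intro hw
  refine hsum (summable_of_sum_range_le (c := ∑' k, stepWeight a s x k)
    (fun t => (ha _ (by omega)).le) fun m => ?_)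
  obtain ⟨T, hT, hTm⟩ := (Nat.frequently_atTop_iff_infinite.1 hx).exists_subset_card_eq m
  obtain ⟨K, hK⟩ := T.exists_nat_subset_range
  have hm : m ≤ ((Finset.range K).filter fun i => s i = x).card := by
    rw [← hTm]
    exact Finset.card_le_card fun i hi => Finset.mem_filter.2 ⟨hK hi, hT hi⟩
  calc ∑ j ∈ Finset.range m, a (j + 1)
      ≤ ∑ j ∈ Finset.range ((Finset.range K).filter fun i => s i = x).card, a (j + 1) :=
        Finset.sum_le_sum_of_subset_of_nonneg (Finset.range_mono hm)
          fun j _ _ => (ha _ (by omega)).le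
    _ = ∑ i ∈ Finset.range K, stepWeight a s x i := by
        rw [← sum_visits]
        refine Finset.sum_congr rfl fun i _ => ?_
        unfold stepWeight; split_ifs <;> simp
    _ ≤ _ := hw.sum_le_tsum _ fun i _ => stepWeight_nonneg ha s x i

/-! ### Weighted series of martingale differences -/

lemma integral_mul_eq_zero_of_condExp_eq_zero {Ω : Type*} {m m0 : MeasurableSpace Ω}
    {P : Measure Ω} [IsProbabilityMeasure P] (hm : m ≤ m0) {N D : Ω → ℝ}
    (hN : StronglyMeasurable[m] N) (hD : Integrable D P) (hND : Integrable (N * D) P)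
    (h0 : P[D | m] =ᵐ[P] 0) : ∫ ω, N ω * D ω ∂P = 0 := by
  have h1 : ∫ ω, (P[N * D | m]) ω ∂P = ∫ ω, (N * D) ω ∂P := integral_condExp hm
  have h2 : P[N * D | m] =ᵐ[P] 0 := by
    refine (condExp_mul_of_stronglyMeasurable_left hN hND hD).trans ?_
    filter_upwards [h0] with ω h
    simp [h]
  rw [integral_congr_ae h2] at h1
  simpa using h1.symm

/-- Bounded martingale differences with square-summable weights form an `L²`-bounded martingale, so the
weighted series converges almost surely. -/
lemma ae_exists_tendsto_sum_martingaleDifference {Ω : Type*} {m0 : MeasurableSpace Ω}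
    {P : Measure Ω} [IsProbabilityMeasure P] (𝓖 : Filtration ℕ m0) {D : ℕ → Ω → ℝ} {b : ℕ → ℝ}
    {K : ℝ} (hD : ∀ k, StronglyMeasurable[𝓖 (k + 1)] (D k))
    (hK : ∀ k, ∀ᵐ ω ∂P, |D k ω| ≤ K) (h0 : ∀ k, P[D k | 𝓖 k] =ᵐ[P] 0)
    (hb : Summable fun k => b k ^ 2) :
    ∀ᵐ ω ∂P, ∃ σ, Tendsto (fun k => ∑ i ∈ Finset.range k, b i * D i ω) atTop (𝓝 σ) := by
  set N : ℕ → Ω → ℝ := fun k ω => ∑ i ∈ Finset.range k, b i * D i ω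
  have hDm : ∀ k, StronglyMeasurable (D k) := fun k => (hD k).mono (𝓖.le _)
  have hNsucc : ∀ k ω, N (k + 1) ω = N k ω + b k * D k ω := fun k ω => Finset.sum_range_succ _ _
  have hNad : ∀ k, StronglyMeasurable[𝓖 k] (N k) := by
    intro k
    refine Finset.stronglyMeasurable_fun_sum _ fun i hi => ?_
    exact ((hD i).mono (𝓖.mono (Finset.mem_range.1 hi))).const_mul (b i)
  have hNm : ∀ k, StronglyMeasurable (N k) := fun k => (hNad k).mono (𝓖.le _)
  have hNbdd : ∀ k, ∃ C : ℝ, ∀ᵐ ω ∂P, |N k ω| ≤ C := by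
    intro k
    induction k with
    | zero => exact ⟨0, by simp [N]⟩
    | succ k ih =>
      obtain ⟨C, hC⟩ := ih
      refine ⟨C + |b k| * K, ?_⟩
      filter_upwards [hC, hK k] with ω h1 h2
      rw [hNsucc]
      refine (abs_add_le _ _).trans ?_
      rw [abs_mul]
      gcongr
  have bdd_int : ∀ {f : Ω → ℝ} (C : ℝ), StronglyMeasurable f → (∀ᵐ ω ∂P, |f ω| ≤ C) →
      Integrable f P := fun C hf h => Integrable.of_bound hf.aestronglyMeasurable C h
  have hDint : ∀ k, Integrable (D k) P := fun k => bdd_int K (hDm k) (hK k)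
  have hNint : ∀ k, Integrable (N k) P := fun k => bdd_int _ (hNm k) (hNbdd k).choose_spec
  have hND : ∀ k, Integrable (N k * D k) P := by
    intro k
    obtain ⟨C, hC⟩ := hNbdd k
    refine bdd_int (C * K) ((hNm k).mul (hDm k)) ?_
    filter_upwards [hC, hK k] with ω h1 h2
    rw [Pi.mul_apply, abs_mul]
    exact mul_le_mul h1 h2 (abs_nonneg _) ((abs_nonneg _).trans h1)
  have hN2 : ∀ k, Integrable (fun ω => N k ω ^ 2) P := by
    intro k
    obtain ⟨C, hC⟩ := hNbdd k
    refine bdd_int (C ^ 2) ((hNm k).pow 2) ?_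
    filter_upwards [hC] with ω h1
    rw [abs_pow]
    gcongr
  have hD2 : ∀ k, ∀ᵐ ω ∂P, D k ω ^ 2 ≤ K ^ 2 := by
    intro k
    filter_upwards [hK k] with ω h1
    exact sq_le_sq' (abs_le.1 h1).1 (abs_le.1 h1).2
  have hD2int : ∀ k, Integrable (fun ω => D k ω ^ 2) P := by
    intro k
    refine bdd_int (K ^ 2) ((hDm k).pow 2) ?_
    filter_upwards [hD2 k] with ω h1
    rwa [abs_of_nonneg (sq_nonneg _)]
  have hsecond : ∀ k, ∫ ω, N k ω ^ 2 ∂P ≤ ∑ i ∈ Finset.range k, b i ^ 2 * K ^ 2 := by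
    intro k
    induction k with
    | zero => simp [N]
    | succ k ih =>
      have hcross := integral_mul_eq_zero_of_condExp_eq_zero (𝓖.le k) (hNad k) (hDint k) (hND k)
        (h0 k)
      have hD2le : ∫ ω, D k ω ^ 2 ∂P ≤ K ^ 2 := by
        simpa using integral_mono_ae (hD2int k) (integrable_const (K ^ 2)) (hD2 k)
      have e : ∫ ω, N (k + 1) ω ^ 2 ∂P =
          ∫ ω, N k ω ^ 2 ∂P + 2 * b k * ∫ ω, N k ω * D k ω ∂P
            + b k ^ 2 * ∫ ω, D k ω ^ 2 ∂P := by
        have hND' : Integrable (fun ω => 2 * b k * (N k ω * D k ω)) P := (hND k).const_mul _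
        have hsum2 : Integrable (fun ω => N k ω ^ 2 + 2 * b k * (N k ω * D k ω)) P :=
          (hN2 k).add hND'
        rw [← integral_const_mul, ← integral_const_mul, ← integral_add (hN2 k) hND',
          ← integral_add hsum2 ((hD2int k).const_mul _)]
        refine integral_congr_ae (Eventually.of_forall fun ω => ?_)
        simp only [hNsucc]
        ring
      rw [e, hcross, Finset.sum_range_succ, mul_zero, add_zero]
      exact add_le_add ih (mul_le_mul_of_nonneg_left hD2le (sq_nonneg _))
  have hmart : Martingale N 𝓖 P := by
    refine martingale_of_condExp_sub_eq_zero_nat hNad hNint fun k => ?_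
    have e : N (k + 1) - N k = b k • D k := by
      ext ω; simp [hNsucc]
    rw [e]
    filter_upwards [condExp_smul (μ := P) (b k) (D k) (𝓖 k), h0 k] with ω h1 h2
    rw [h1, Pi.smul_apply, h2]; simp
  set B : ℝ := 1 + (∑' k, b k ^ 2) * K ^ 2
  have hL1 : ∀ k, eLpNorm (N k) 1 P ≤ (B.toNNReal : ENNReal) := by
    intro k
    rw [eLpNorm_one_eq_lintegral_enorm, ← ofReal_integral_norm_eq_lintegral_enorm (hNint k)]
    refine ENNReal.ofReal_le_ofReal ?_
    calc ∫ ω, ‖N k ω‖ ∂P ≤ ∫ ω, (1 + N k ω ^ 2) ∂P := by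
          refine integral_mono (hNint k).norm ((integrable_const _).add (hN2 k)) fun ω => ?_
          simp only [Real.norm_eq_abs]
          nlinarith [sq_abs (N k ω), sq_nonneg (|N k ω| - 1)]
      _ = 1 + ∫ ω, N k ω ^ 2 ∂P := by
          rw [integral_add (integrable_const _) (hN2 k)]; simp
      _ ≤ B := by
          refine add_le_add le_rfl ((hsecond k).trans ?_)
          rw [← Finset.sum_mul]
          exact mul_le_mul_of_nonneg_right (hb.sum_le_tsum _ fun _ _ => sq_nonneg _)
            (sq_nonneg _)
  exact hmart.submartingale.exists_ae_tendsto_of_bdd hL1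

/-! ### Uniformly ergodic Markov processes -/

/-- Closeness in total variation controls the integrals of bounded functions, by the layer-cake
formula. -/
lemma abs_integral_sub_integral_le {E : Type*} [MeasurableSpace E] {μ ν : Measure E}
    [IsFiniteMeasure μ] [IsFiniteMeasure ν] {δ K : ℝ}
    (h : ∀ B, MeasurableSet B → |μ.real B - ν.real B| ≤ δ) {p : E → ℝ} (hp : Measurable p)
    (hp0 : ∀ x, 0 ≤ p x) (hpK : ∀ x, p x ≤ K) (hK : 0 ≤ K) :
    |∫ x, p x ∂μ - ∫ x, p x ∂ν| ≤ K * δ := by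
  have hint : ∀ (ρ : Measure E) [IsFiniteMeasure ρ], Integrable p ρ := fun ρ _ =>
    Integrable.of_bound hp.aestronglyMeasurable K
      (Eventually.of_forall fun x => by rw [Real.norm_of_nonneg (hp0 x)]; exact hpK x)
  have hlayer : ∀ (ρ : Measure E) [IsFiniteMeasure ρ],
      IntegrableOn (fun t => ρ.real {x | t ≤ p x}) (Set.Ioc 0 K) := by
    intro ρ _
    have hanti : Antitone fun t => ρ.real {x | t ≤ p x} := fun s t hst =>
      measureReal_mono fun x hx => le_trans hst hx
    refine Integrable.of_bound hanti.measurable.aestronglyMeasurable (ρ.real Set.univ) ?_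
    refine Eventually.of_forall fun t => ?_
    rw [Real.norm_of_nonneg measureReal_nonneg]
    exact measureReal_mono (Set.subset_univ _)
  rw [(hint μ).integral_eq_integral_Ioc_meas_le (Eventually.of_forall hp0)
      (Eventually.of_forall hpK),
    (hint ν).integral_eq_integral_Ioc_meas_le (Eventually.of_forall hp0)
      (Eventually.of_forall hpK), ← integral_sub (hlayer μ) (hlayer ν)]
  have := norm_setIntegral_le_of_norm_le_const (μ := volume) (s := Set.Ioc (0 : ℝ) K)
    (f := fun t => μ.real {x | t ≤ p x} - ν.real {x | t ≤ p x}) (C := δ) (by simp)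
    (fun t _ => h _ (measurableSet_le measurable_const hp))
  simpa [Real.norm_eq_abs, hK, mul_comm] using this

lemma isMarkovKernel_pow {E : Type*} [MeasurableSpace E] (κ : Kernel E E) [IsMarkovKernel κ]
    (m : ℕ) : IsMarkovKernel (κ ^ m) := by
  induction m with
  | zero => rw [pow_zero]; exact inferInstanceAs (IsMarkovKernel Kernel.id)
  | succ m ih => rw [pow_succ]; exact inferInstanceAs (IsMarkovKernel (_ ∘ₖ _))

/-- The filtration generated by a measurable process: at time `k`, its past up to and including `k`. -/
def pastFiltration {Ω E : Type*} [m0 : MeasurableSpace Ω] [MeasurableSpace E] (X : ℕ → Ω → E)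
    (hX : ∀ k, Measurable (X k)) : Filtration ℕ m0 where
  seq k := ⨆ i ≤ k, MeasurableSpace.comap (X i) inferInstance
  mono' _ _ hjk := iSup₂_le fun i hi => le_iSup₂_of_le i (hi.trans hjk) le_rfl
  le' _ := iSup₂_le fun i _ => (hX i).comap_le

section Markov

variable {Ω E : Type*} [MeasurableSpace Ω] [MeasurableSpace E] {P : Measure Ω}
  [IsProbabilityMeasure P] {X : ℕ → Ω → E} {κ : Kernel E E} [IsMarkovKernel κ]

/-- The Markov property as an identity between laws: on an event of the past, the law of the next point
is obtained from the law of the present one by applying the kernel. -/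
lemma IsMarkovProcess.map_restrict_succ (h : IsMarkovProcess P X κ) (hX : ∀ k, Measurable (X k))
    {k : ℕ} {C : Set Ω} (hC : MeasurableSet[pastFiltration X hX k] C) :
    (P.restrict C).map (X (k + 1)) = ((P.restrict C).map (X k)).bind κ := by
  have hle := (pastFiltration X hX).le k
  ext B hB
  rw [Measure.map_apply (hX _) hB, Measure.bind_apply hB κ.measurable.aemeasurable,
    lintegral_map (κ.measurable_coe hB) (hX k)]
  have hBm := hX (k + 1) hB
  have h1 : ∫ ω in C, (κ (X k ω)).real B ∂P = (P.restrict C).real (X (k + 1) ⁻¹' B) := by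
    rw [← setIntegral_congr_ae (hle _ hC) ((h k B hB).mono fun ω hω _ => hω)]
    refine (setIntegral_condExp hle ((integrable_const (1 : ℝ)).indicator hBm) hC).trans ?_
    rw [integral_indicator_const _ hBm]
    simp
  rw [← ENNReal.toReal_eq_toReal_iff' (measure_ne_top _ _)
    (((lintegral_mono fun ω => prob_le_one).trans_lt (by simp)).ne)]
  refine h1.symm.trans ?_
  rw [← integral_toReal]
  · rfl
  · exact ((κ.measurable_coe hB).comp (hX k)).aemeasurable
  · exact Eventually.of_forall fun ω => measure_lt_top _ _

lemma IsMarkovProcess.map_restrict_add (h : IsMarkovProcess P X κ) (hX : ∀ k, Measurable (X k))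
    {k : ℕ} {C : Set Ω} (hC : MeasurableSet[pastFiltration X hX k] C) (m : ℕ) :
    (P.restrict C).map (X (k + m)) = ((P.restrict C).map (X k)).bind (κ ^ m : Kernel E E) := by
  induction m with
  | zero =>
    rw [pow_zero]
    exact (Measure.id_comp (μ := (P.restrict C).map (X k))).symm
  | succ m ih =>
    rw [← add_assoc, h.map_restrict_succ hX ((pastFiltration X hX).mono (Nat.le_add_right k m) _ hC),
      ih, pow_succ', Measure.comp_assoc]
    rfl

/-- The `m`-step Markov property for bounded functions. -/
lemma IsMarkovProcess.condExp_add (h : IsMarkovProcess P X κ) (hX : ∀ k, Measurable (X k))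
    {p : E → ℝ} {K : ℝ} (hp : Measurable p) (hpK : ∀ x, |p x| ≤ K) (k m : ℕ) :
    P[fun ω => p (X (k + m) ω) | pastFiltration X hX k] =ᵐ[P]
      fun ω => ∫ y, p y ∂((κ ^ m) (X k ω)) := by
  have := isMarkovKernel_pow κ m
  have hle := (pastFiltration X hX).le k
  have hint : ∀ (ρ : Measure E) [IsFiniteMeasure ρ], Integrable p ρ := fun ρ _ =>
    Integrable.of_bound hp.aestronglyMeasurable K (Eventually.of_forall hpK)
  have hgm : StronglyMeasurable fun x => ∫ y, p y ∂((κ ^ m) x) :=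
    hp.stronglyMeasurable.integral_kernel
  have hgK : ∀ x, ‖∫ y, p y ∂((κ ^ m) x)‖ ≤ K := fun x => by
    simpa using norm_integral_le_of_norm_le_const (μ := (κ ^ m) x) (f := p) (Eventually.of_forall hpK)
  have hXk : Measurable[pastFiltration X hX k] (X k) :=
    Measurable.mono (comap_measurable (X k)) (le_iSup₂_of_le k le_rfl le_rfl) le_rfl
  refine (ae_eq_condExp_of_forall_setIntegral_eq hle ?_ ?_ ?_ ?_).symm
  · exact Integrable.of_bound (hp.comp (hX _)).aestronglyMeasurable K
      (Eventually.of_forall fun ω => hpK _)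
  · intro C _ _
    exact (Integrable.of_bound (hgm.comp_measurable (hX k)).aestronglyMeasurable K
      (Eventually.of_forall fun ω => hgK _)).integrableOn
  · intro C hC _
    rw [← integral_map (μ := P.restrict C) (hX k).aemeasurable (f := fun x => ∫ y, p y ∂((κ ^ m) x))
        hgm.aestronglyMeasurable,
      ← integral_map (μ := P.restrict C) (hX (k + m)).aemeasurable (f := p)
        hp.aestronglyMeasurable,
      h.map_restrict_add hX hC m]
    rw [← Measure.snd_compProd, Measure.snd, integral_map measurable_snd.aemeasurable
      hp.aestronglyMeasurable, Measure.integral_compProd]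
    exact Integrable.of_bound (hp.comp measurable_snd).aestronglyMeasurable K
      (Eventually.of_forall fun z => hpK z.2)
  · exact (hgm.measurable.comp hXk).stronglyMeasurable.aestronglyMeasurable

/-- Along a uniformly ergodic Markov process, a bounded function is, up to an arbitrarily small error, its
mean under the limiting law plus a noise whose series converges almost surely for all square-summable
weights. Ergodicity makes the prediction of `p (X k)` from the past `m` steps earlier almost equal to the
mean; the rest is a telescoping sum of `m` martingale differences. -/
lemma IsMarkovProcess.ae_exists_noise (h : IsMarkovProcess P X κ) (hX : ∀ k, Measurable (X k))
    {π : Measure E} [IsProbabilityMeasure π] (hκ : IsErgodicKernel κ π) {p : E → ℝ} {K : ℝ}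
    (hp : Measurable p) (hp0 : ∀ x, 0 ≤ p x) (hpK : ∀ x, p x ≤ K) {b : ℕ → ℝ}
    (hb : Summable fun k => b k ^ 2) {ε : ℝ} (hε : 0 < ε) :
    ∀ᵐ ω ∂P, ∃ d : ℕ → ℝ,
      (∃ σ, Tendsto (fun k => ∑ i ∈ Finset.range k, b i * d i) atTop (𝓝 σ)) ∧
        ∀ᶠ k in atTop, |p (X k ω) - ∫ x, p x ∂π - d k| ≤ ε := by
  obtain ⟨ω₀⟩ : Nonempty Ω := P.nonempty_of_neZero
  have hK : 0 ≤ K := (hp0 (X 0 ω₀)).trans (hpK _)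
  have hpK' : ∀ x, |p x| ≤ K := fun x => by rw [abs_of_nonneg (hp0 x)]; exact hpK x
  obtain ⟨m, hm⟩ := hκ (ε / (K + 1)) (by positivity)
  set 𝓕 := pastFiltration X hX
  -- `U k i` predicts `p (X k)` from the past `i` steps before time `k`.
  set U : ℕ → ℕ → Ω → ℝ := fun k i => P[fun ω => p (X k ω) | 𝓕 (k - i)]
  have hUbdd : ∀ k i, ∀ᵐ ω ∂P, |U k i ω| ≤ K := fun k i =>
    ae_bdd_abs_condExp_of_ae_bdd_abs (Eventually.of_forall fun ω => hpK' _)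
  have hU0 : ∀ k, ∀ᵐ ω ∂P, U k 0 ω = p (X k ω) := by
    intro k
    have hXk : Measurable[𝓕 k] (X k) :=
      Measurable.mono (comap_measurable (X k)) (le_iSup₂_of_le k le_rfl le_rfl) le_rfl
    have e : U k 0 = fun ω => p (X k ω) :=
      condExp_of_stronglyMeasurable (𝓕.le k) (hp.comp hXk).stronglyMeasurable
        (Integrable.of_bound (hp.comp (hX _)).aestronglyMeasurable K
          (Eventually.of_forall fun ω => hpK' _))
    exact Eventually.of_forall fun ω => congrFun e ω
  have hUm : ∀ k, m ≤ k → ∀ᵐ ω ∂P, |U k m ω - ∫ x, p x ∂π| ≤ ε := by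
    intro k hk
    have h1 := h.condExp_add hX hp hpK' (k - m) m
    rw [Nat.sub_add_cancel hk] at h1
    filter_upwards [h1] with ω hω
    have := isMarkovKernel_pow κ m
    have h2 := abs_integral_sub_integral_le (hm m le_rfl (X (k - m) ω)) hp hp0 hpK hK
    refine (le_of_eq (by rw [← hω])).trans (h2.trans ?_)
    rw [mul_div_assoc', div_le_iff₀ (by positivity)]
    nlinarith
  have hD : ∀ i < m, ∀ᵐ ω ∂P, ∃ σ, Tendsto (fun k => ∑ j ∈ Finset.range k,
      b (m + j) * (U (m + j) i ω - U (m + j) (i + 1) ω)) atTop (𝓝 σ) := by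
    intro i hi
    -- The shift by `m` keeps all indices `m + j - i - 1` nonnegative.
    let 𝓖 : Filtration ℕ _ :=
      { seq := fun j => 𝓕 (m + j - (i + 1))
        mono' := fun j k hjk => 𝓕.mono (by omega)
        le' := fun j => 𝓕.le _ }
    refine ae_exists_tendsto_sum_martingaleDifference 𝓖
      (D := fun j ω => U (m + j) i ω - U (m + j) (i + 1) ω) (b := fun j => b (m + j))
      (K := K + K) ?_ ?_ ?_ ?_
    · intro j
      refine StronglyMeasurable.sub ?_ ?_
      · exact stronglyMeasurable_condExp.mono (𝓕.mono (by omega))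
      · exact stronglyMeasurable_condExp.mono (𝓕.mono (by omega))
    · intro j
      filter_upwards [hUbdd (m + j) i, hUbdd (m + j) (i + 1)] with ω h1 h2
      exact (abs_sub _ _).trans (add_le_add h1 h2)
    · intro j
      have h1 := condExp_sub (μ := P) (f := U (m + j) i) (g := U (m + j) (i + 1))
        integrable_condExp integrable_condExp (𝓖 j)
      have h2 : P[U (m + j) i | 𝓖 j] =ᵐ[P] U (m + j) (i + 1) :=
        condExp_condExp_of_le (𝓕.mono (by omega)) (𝓕.le _)
      have h3 : P[U (m + j) (i + 1) | 𝓖 j] =ᵐ[P] U (m + j) (i + 1) :=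
        condExp_condExp_of_le le_rfl (𝓕.le _)
      refine h1.trans ?_
      filter_upwards [h2, h3] with ω e2 e3
      simp [e2, e3]
    · simpa only [add_comm m] using (summable_nat_add_iff m).2 hb
  have hD' : ∀ᵐ ω ∂P, ∀ i < m, ∃ σ, Tendsto (fun k => ∑ j ∈ Finset.range k,
      b (m + j) * (U (m + j) i ω - U (m + j) (i + 1) ω)) atTop (𝓝 σ) := by
    rw [ae_all_iff]
    intro i
    by_cases hi : i < m
    · filter_upwards [hD i hi] with ω hω _ using hω
    · exact Eventually.of_forall fun ω hi' => absurd hi' hi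
  have hUm' : ∀ᵐ ω ∂P, ∀ k, m ≤ k → |U k m ω - ∫ x, p x ∂π| ≤ ε := by
    rw [ae_all_iff]
    intro k
    by_cases hk : m ≤ k
    · filter_upwards [hUm k hk] with ω hω _ using hω
    · exact Eventually.of_forall fun ω hk' => absurd hk' hk
  filter_upwards [hD', ae_all_iff.2 hU0, hUm'] with ω h1 h2 h3
  refine ⟨fun k => U k 0 ω - U k m ω, ?_, ?_⟩
  · choose! σ hσ using h1
    refine ⟨∑ i ∈ Finset.range m, b i * (U i 0 ω - U i m ω) + ∑ i ∈ Finset.range m, σ i, ?_⟩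
    rw [← tendsto_add_atTop_iff_nat m]
    have h4 : Tendsto (fun k => ∑ i ∈ Finset.range m, ∑ j ∈ Finset.range k,
        b (m + j) * (U (m + j) i ω - U (m + j) (i + 1) ω)) atTop
        (𝓝 (∑ i ∈ Finset.range m, σ i)) :=
      tendsto_finsetSum _ fun i hi => hσ i (Finset.mem_range.1 hi)
    refine (h4.const_add (∑ i ∈ Finset.range m, b i * (U i 0 ω - U i m ω))).congr fun k => ?_
    rw [add_comm k m, Finset.sum_range_add, Finset.sum_comm]
    congr 1
    refine Finset.sum_congr rfl fun j _ => ?_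
    rw [← Finset.mul_sum, Finset.sum_range_sub' (fun i => U (m + j) i ω)]
  · filter_upwards [eventually_ge_atTop m] with k hk
    rw [← h2 k]
    simpa [sub_sub_sub_comm, abs_sub_comm] using h3 k hk

end Markov

/-! ### Recurrence of the cell states -/

/-- The path of cell states from `s₀` driven by the arrivals `A`. -/
def statePath (s₀ : CellState l) (A : ℕ → Fin n → ℕ) : ℕ → CellState l
  | 0 => s₀
  | k + 1 => (statePath s₀ A k).next (A k)

lemma statePath_congr (s₀ : CellState l) {A A' : ℕ → Fin n → ℕ} {m : ℕ}
    (h : ∀ i < m, A i = A' i) : statePath s₀ A m = statePath s₀ A' m := by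
  induction m with
  | zero => rfl
  | succ m ih =>
    rw [statePath, statePath, ih fun i hi => h i (by omega), h m (by omega)]

lemma statePath_add (s₀ : CellState l) (A : ℕ → Fin n → ℕ) (k m : ℕ) :
    statePath s₀ A (k + m) = statePath (statePath s₀ A k) (fun i => A (k + i)) m := by
  induction m with
  | zero => rfl
  | succ m ih => rw [← add_assoc, statePath, ih, statePath]

lemma statePath_eq_iterate_add (s₀ : CellState l) (A : ℕ → Fin n → ℕ) (m : ℕ) :
    statePath s₀ A m = (Multiset.filterMap MobileUser.age)^[m] s₀ + statePath 0 A m := by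
  induction m with
  | zero => simp [statePath]
  | succ m ih =>
    rw [statePath, statePath, ih, Function.iterate_succ_apply', CellState.next, CellState.next,
      Multiset.filterMap_add, add_assoc]

lemma residual_add_le_of_mem_iterate {L : ℕ} (hL : ∀ k, (l k : ℕ) ≤ L) (s₀ : CellState l) (m : ℕ) :
    ∀ u ∈ (Multiset.filterMap MobileUser.age)^[m] s₀, u.residual + m ≤ L := by
  induction m with
  | zero => exact fun u _ => u.residual_le.trans (hL _)
  | succ m ih =>
    intro u hu
    rw [Function.iterate_succ_apply', Multiset.mem_filterMap] at hu
    obtain ⟨v, hv, hvu⟩ := hu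
    have h1 := ih v hv
    unfold MobileUser.age at hvu
    split_ifs at hvu with h
    obtain rfl := Option.some.inj hvu
    simp only
    omega

/-- After as many slots as the longest line has, all the initial users have left: the initial state is
forgotten. -/
lemma statePath_eq_of_le {L : ℕ} (hL : ∀ k, (l k : ℕ) ≤ L) (s₀ s₁ : CellState l)
    (A : ℕ → Fin n → ℕ) : statePath s₀ A L = statePath s₁ A L := by
  have key : ∀ s : CellState l, (Multiset.filterMap MobileUser.age)^[L] s = 0 := by
    intro s
    refine Multiset.eq_zero_of_forall_notMem fun u hu => ?_
    have := residual_add_le_of_mem_iterate hL s L u hu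
    have := u.residual_pos
    omega
  rw [statePath_eq_iterate_add s₀, statePath_eq_iterate_add s₁, key, key]

/-- A state of positive steady-state probability can be reached in any given number of slots through
arrivals of positive probability. -/
lemma IsSteadyState.exists_statePath {Ω : Type*} [MeasurableSpace Ω] {P : Measure Ω}
    {B : Ω → Fin n → ℕ} {g : PMF (CellState l)} (hg : IsSteadyState P B g) (m : ℕ) :
    ∀ x, g x ≠ 0 → ∃ (s₀ : CellState l) (v : ℕ → Fin n → ℕ),
      (∀ i < m, P (B ⁻¹' {v i}) ≠ 0) ∧ statePath s₀ v m = x := by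
  induction m with
  | zero => exact fun x _ => ⟨x, fun _ => 0, by simp, rfl⟩
  | succ m ih =>
    intro x hx
    rw [hg x] at hx
    obtain ⟨s, hs⟩ : ∃ s, g s * P {ω | s.next (B ω) = x} ≠ 0 := by
      by_contra! h
      exact hx (by simp [h])
    obtain ⟨a, ha, hsa⟩ : ∃ a, P (B ⁻¹' {a}) ≠ 0 ∧ s.next a = x := by
      by_contra! h
      refine right_ne_zero_of_mul hs (measure_mono_null (t := ⋃ a ∈ {a | s.next a = x}, B ⁻¹' {a})
        (fun ω hω => by simpa using hω) ?_)
      refine (measure_biUnion_null_iff (Set.to_countable _)).2 fun a ha => ?_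
      by_contra h'
      exact h a h' ha
    obtain ⟨s₀, v, hv, hvs⟩ := ih s (left_ne_zero_of_mul hs)
    refine ⟨s₀, Function.update v m a, fun i hi => ?_, ?_⟩
    · rcases Nat.lt_succ_iff_lt_or_eq.1 hi with h | rfl
      · rw [Function.update_of_ne h.ne]; exact hv i h
      · rwa [Function.update_self]
    · rw [statePath, Function.update_self, ← hsa, ← hvs]
      congr 1
      exact statePath_congr _ fun i hi => Function.update_of_ne hi.ne _ _

/-- A pattern of finitely many values of positive probability occurs infinitely often, in disjoint
blocks, in an i.i.d. sequence. -/
lemma ae_frequently_block {Ω E : Type*} [MeasurableSpace Ω] {P : Measure Ω} [IsProbabilityMeasure P]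
    [MeasurableSpace E] [MeasurableSingletonClass E] {A : ℕ → Ω → E} (hA : ∀ k, Measurable (A k))
    (hindep : iIndepFun A P) (hident : ∀ k, IdentDistrib (A k) (A 0) P P) {L : ℕ} (v : ℕ → E)
    (hv : ∀ i < L, P (A 0 ⁻¹' {v i}) ≠ 0) :
    ∀ᵐ ω ∂P, ∃ᶠ j in atTop, ∀ i < L, A (j * L + i) ω = v i := by
  set B : ℕ → Set Ω := fun j => ⋂ i : Fin L, A (j * L + i) ⁻¹' {v i}
  have hBm : ∀ j, MeasurableSet (B j) := fun j =>
    MeasurableSet.iInter fun i => hA _ (measurableSet_singleton _)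
  have hinj : Function.Injective fun q : ℕ × Fin L => q.1 * L + (q.2 : ℕ) := by
    rintro ⟨j, i⟩ ⟨j', i'⟩ h
    simp only at h
    have hL : 0 < L := i.pos
    have h1 := congrArg (· / L) h
    have h2 := congrArg (· % L) h
    simp only [Nat.mul_comm _ L, Nat.mul_add_div hL,
      Nat.div_eq_of_lt i.2, Nat.div_eq_of_lt i'.2, Nat.mul_add_mod, Nat.mod_eq_of_lt i.2,
      Nat.mod_eq_of_lt i'.2, add_zero] at h1 h2
    exact Prod.ext h1 (Fin.ext h2)
  have hprod : ∀ T : Finset ℕ,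
      P (⋂ j ∈ T, B j) = ∏ _j ∈ T, ∏ i : Fin L, P (A 0 ⁻¹' {v i}) := by
    intro T
    have h := (hindep.precomp hinj).measure_inter_preimage_eq_mul (T ×ˢ Finset.univ)
      (sets := fun q => {v q.2}) fun q _ => measurableSet_singleton _
    rw [Finset.prod_product] at h
    have e : (⋂ q ∈ T ×ˢ (Finset.univ : Finset (Fin L)), A (q.1 * L + q.2) ⁻¹' {v q.2}) =
        ⋂ j ∈ T, B j := by
      ext ω
      simp [B]
      exact ⟨fun h j hj i => h j i hj, fun h j i hj => h j hj i⟩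
    rw [← e, h]
    refine Finset.prod_congr rfl fun j _ => Finset.prod_congr rfl fun i _ => ?_
    exact (hident _).measure_preimage_eq (measurableSet_singleton _)
  have hsingle : ∀ j, P (B j) = ∏ i : Fin L, P (A 0 ⁻¹' {v i}) := fun j => by
    simpa using hprod {j}
  have hB : iIndepSet B P := by
    rw [iIndepSet_iff_meas_biInter hBm]
    intro T
    simp_rw [hprod, hsingle]
  have hsum : ∑' j, P (B j) = ⊤ := by
    simp_rw [hsingle]
    exact ENNReal.tsum_const_eq_top_of_ne_zero (Finset.prod_ne_zero_iff.2 fun i _ => hv i i.2)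
  have hlim := measure_limsup_eq_one hBm hB hsum
  rw [← prob_compl_eq_zero_iff (MeasurableSet.measurableSet_limsup hBm)] at hlim
  filter_upwards [measure_eq_zero_iff_ae_notMem.1 hlim] with ω hω
  rw [Set.notMem_compl_iff, mem_limsup_iff_frequently_mem] at hω
  refine hω.mono fun j hj i hi => ?_
  simpa using Set.mem_iInter.1 hj ⟨i, hi⟩

/-- Almost surely, a state of positive steady-state probability is visited infinitely often, whatever the
initial state. -/
lemma ae_frequently_statePath_eq {Ω : Type*} [MeasurableSpace Ω] {P : Measure Ω}
    [IsProbabilityMeasure P] {A : ℕ → Ω → Fin n → ℕ} (hA : ∀ k, Measurable (A k))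
    (hindep : iIndepFun A P) (hident : ∀ k, IdentDistrib (A k) (A 0) P P)
    {g : PMF (CellState l)} (hg : IsSteadyState P (A 0) g) {x : CellState l} (hx : g x ≠ 0) :
    ∀ᵐ ω ∂P, ∀ s₀ : CellState l, ∃ᶠ k in atTop, statePath s₀ (fun k => A k ω) k = x := by
  -- The block length exceeds all sojourn times and is positive even without any line.
  set L := ∑ k, (l k : ℕ) + 1
  have hL : ∀ k, (l k : ℕ) ≤ L := fun k =>
    (Finset.single_le_sum (f := fun k => (l k : ℕ)) (fun _ _ => Nat.zero_le _)
      (Finset.mem_univ k)).trans (Nat.le_succ _)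
  obtain ⟨s₁, v, hv, hvx⟩ := hg.exists_statePath L x hx
  filter_upwards [ae_frequently_block hA hindep hident v hv] with ω hω s₀
  rw [frequently_atTop] at hω ⊢
  intro N
  obtain ⟨j, hj, hjv⟩ := hω N
  refine ⟨j * L + L, (hj.trans (Nat.le_mul_of_pos_right j (Nat.succ_pos _))).trans
    (Nat.le_add_right _ _), ?_⟩
  rw [statePath_add, statePath_congr _ (A' := v) hjv, statePath_eq_of_le hL _ s₁, hvx]

instance : Countable (MobileUser l) :=
  Function.Injective.countable (f := fun u : MobileUser l => (u.line, u.residual)) fun u v h => by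
    cases u; cases v; simpa using h

instance : Countable (CellState l) :=
  inferInstanceAs (Countable (Quotient (List.isSetoid (MobileUser l))))

lemma measurableSet_statePath_eq (s₀ x : CellState l) (k : ℕ) :
    MeasurableSet {A : ℕ → Fin n → ℕ | statePath s₀ A k = x} := by
  let : MeasurableSpace (CellState l) := ⊤
  have : DiscreteMeasurableSpace (CellState l) := ⟨fun _ => trivial⟩
  have h : Measurable fun A : ℕ → Fin n → ℕ => statePath s₀ A k := by
    induction k with
    | zero => exact measurable_const
    | succ k ih =>
      exact (Measurable.of_discrete (f := fun q : CellState l × (Fin n → ℕ) => q.1.next q.2)).comp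
        (ih.prodMk (measurable_pi_apply k))
  exact h (measurableSet_singleton x)

/-! ### Rates as functions of the fading gains -/

lemma abs_rpow_sub_rpow_le {α u v : ℝ} (hα0 : 0 < α) (hα1 : α ≤ 1) (hu : 0 ≤ u) (hv : 0 ≤ v) :
    |u ^ α - v ^ α| ≤ |u - v| ^ α := by
  wlog huv : v ≤ u generalizing u v
  · rw [abs_sub_comm, abs_sub_comm u]; exact this hv hu (le_of_not_ge huv)
  have h1 := Real.rpow_add_le_add_rpow (sub_nonneg.2 huv) hv hα0.le hα1
  rw [sub_add_cancel] at h1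
  rw [abs_of_nonneg (sub_nonneg.2 huv),
    abs_of_nonneg (sub_nonneg.2 (Real.rpow_le_rpow hv huv hα0.le))]
  linarith

/-- For bounded gains, the `α`-th power of a rate is a uniform limit of bounded nonnegative measurable
functions of finitely many gains. -/
lemma IsRateFunction.exists_rpow_approx {Link : Type*} {S : Set ℝ} (hS0 : ∀ x ∈ S, 0 ≤ x)
    (hSb : Bornology.IsBounded S) {r : (Link → ℝ) → ℝ} (hr : IsRateFunction r) {α : ℝ}
    (hα0 : 0 < α) (hα1 : α ≤ 1) {ε : ℝ} (hε : 0 < ε) :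
    ∃ (F : Finset Link) (p : (F → S) → ℝ) (K : ℝ), Measurable p ∧ (∀ y, 0 ≤ p y) ∧
      (∀ y, p y ≤ K) ∧
      ∀ x : Link → S, |(r fun b => (x b : ℝ)) ^ α - p fun b : F => x b| ≤ ε := by
  obtain ⟨c, hc⟩ := hSb.bddAbove
  have hx : ∀ (x : Link → S) (b : Link), 0 ≤ (x b : ℝ) ∧ (x b : ℝ) ≤ c := fun x b =>
    ⟨hS0 _ (x b).2, hc (x b).2⟩
  obtain ⟨C, hC⟩ := hr.bounded c
  obtain ⟨F, q, hq, hrq⟩ := hr.approx c (ε ^ (1 / α)) (Real.rpow_pos_of_pos hε _)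
  -- Clamping the approximation to the range of the rate keeps it as close and makes it bounded.
  set t : (F → S) → ℝ := fun y => max (min (q fun b => (y b : ℝ)) (max C 0)) 0
  have ht0 : ∀ y, 0 ≤ t y := fun y => le_max_right _ _
  have htC : ∀ y, t y ≤ max C 0 := fun y => max_le (min_le_right _ _) (le_max_right _ _)
  refine ⟨F, fun y => t y ^ α, max C 0 ^ α, ?_, fun y => Real.rpow_nonneg (ht0 y) _,
    fun y => Real.rpow_le_rpow (ht0 y) (htC y) hα0.le, fun x => ?_⟩
  · have hcoe : Measurable fun (y : F → S) (b : F) => (y b : ℝ) :=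
      measurable_pi_lambda _ fun b => measurable_subtype_coe.comp (measurable_pi_apply b)
    exact (((hq.comp hcoe).min measurable_const).max measurable_const).pow_const α
  · have h0 := hr.nonneg (fun b => (x b : ℝ)) fun b => (hx x b).1
    have h1 := hC (fun b => (x b : ℝ)) (hx x)
    have h2 := hrq (fun b => (x b : ℝ)) (hx x)
    refine (abs_rpow_sub_rpow_le hα0 hα1 h0 (ht0 _)).trans ?_
    have h3 : |(r fun b => (x b : ℝ)) - t fun b : F => x b| ≤ ε ^ (1 / α) := by
      refine le_trans ?_ h2
      have e1 : max (min (r fun b => (x b : ℝ)) (max C 0)) 0 = r fun b => (x b : ℝ) := by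
        rw [min_eq_left (h1.trans (le_max_left _ _)), max_eq_left h0]
      have e2 := (abs_max_sub_max_le_abs (min (r fun b => (x b : ℝ)) (max C 0))
        (min (q fun b : F => (x b : ℝ)) (max C 0)) 0).trans (abs_min_sub_min_le_max _ _ _ _)
      rw [e1] at e2
      simpa using e2
    calc _ ≤ (ε ^ (1 / α)) ^ α := Real.rpow_le_rpow (abs_nonneg _) h3 hα0.le
      _ = ε := by rw [← Real.rpow_mul hε.le, one_div_mul_cancel hα0.ne', Real.rpow_one]

lemma IsRateFunction.measurable_rpow {Link : Type*} {S : Set ℝ} (hS0 : ∀ x ∈ S, 0 ≤ x)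
    (hSb : Bornology.IsBounded S) {r : (Link → ℝ) → ℝ} (hr : IsRateFunction r) {α : ℝ}
    (hα0 : 0 < α) (hα1 : α ≤ 1) :
    Measurable fun x : Link → S => (r fun b => (x b : ℝ)) ^ α := by
  choose F p K hp _ _ happ using fun k : ℕ =>
    hr.exists_rpow_approx hS0 hSb hα0 hα1 (Nat.one_div_pos_of_nat (α := ℝ) (n := k))
  refine measurable_of_tendsto_metrizable
    (f := fun k (x : Link → S) => p k fun b : F k => x b) (fun k => ?_) ?_
  · exact (hp k).comp (measurable_pi_lambda _ fun b => measurable_pi_apply _)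
  · rw [tendsto_pi_nhds]
    intro x
    rw [tendsto_iff_dist_tendsto_zero]
    refine squeeze_zero (fun _ => dist_nonneg) (fun k => ?_)
      (tendsto_one_div_add_atTop_nhds_zero_nat (𝕜 := ℝ))
    rw [dist_comm, Real.dist_eq]
    exact happ k x

/-! ### Convergence of the estimates -/

/-- The recursive averages of the samples `u` with step sizes `b`, started at zero. -/
def recursiveAverage (b u : ℕ → ℝ) : ℕ → ℝ
  | 0 => 0
  | k + 1 => recursiveAverage b u k + b k * (u k - recursiveAverage b u k)

/-- The averaging recursion forgets its initial value. -/
lemma tendsto_of_tendsto_recursiveAverage {b u y : ℕ → ℝ} {c : ℝ} (hb0 : ∀ k, 0 ≤ b k)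
    (hbsum : ¬ Summable b) (hblim : Tendsto b atTop (𝓝 0))
    (hy : ∀ k, y (k + 1) = y k + b k * (u k - y k))
    (h : Tendsto (recursiveAverage b u) atTop (𝓝 c)) : Tendsto y atTop (𝓝 c) := by
  have hz : Tendsto (fun k => y k - recursiveAverage b u k) atTop (𝓝 0) := by
    refine tendsto_of_recursion (f := fun _ => 0) hb0 hbsum hblim (fun k => ?_)
      fun ε hε => ⟨fun _ => 0, ⟨0, by simp⟩, by simp [hε.le]⟩
    rw [hy, recursiveAverage]; ring
  simpa using hz.add h

lemma tendsto_zero_of_summable_sq {b : ℕ → ℝ} (hb : Summable fun k => b k ^ 2) :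
    Tendsto b atTop (𝓝 0) := by
  have h := hb.tendsto_atTop_zero.sqrt
  simp only [Real.sqrt_sq_eq_abs, Real.sqrt_zero] at h
  exact (tendsto_zero_iff_abs_tendsto_zero b).2 h

/-- Along deterministic step sizes, the recursive averages of the powers of the rate converge to their
moment under the fading law. -/
lemma IsErgodicFading.ae_tendsto_recursiveAverage {Ω Link : Type*} [MeasurableSpace Ω]
    {P : Measure Ω} [IsProbabilityMeasure P] {S : Set ℝ} {G : ℕ → Ω → Link → S}
    {π : Measure (Link → S)} [IsProbabilityMeasure π] (hG : IsErgodicFading P S G π)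
    {r : (Link → ℝ) → ℝ} (hr : IsRateFunction r) {α : ℝ} (hα0 : 0 < α) (hα1 : α ≤ 1)
    {b : ℕ → ℝ} (hb0 : ∀ k, 0 ≤ b k) (hbsum : ¬ Summable b) (hbsq : Summable fun k => b k ^ 2) :
    ∀ᵐ ω ∂P, Tendsto (recursiveAverage b fun k => (r fun i => (G k ω i : ℝ)) ^ α) atTop
      (𝓝 (rateMoment π α r)) := by
  have hmeas := hr.measurable_rpow hG.nonneg hG.bounded hα0 hα1
  have hnoise : ∀ j : ℕ, ∀ᵐ ω ∂P, ∃ d : ℕ → ℝ,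
      (∃ σ, Tendsto (fun k => ∑ i ∈ Finset.range k, b i * d i) atTop (𝓝 σ)) ∧
        ∀ᶠ k in atTop,
          |(r fun i => (G k ω i : ℝ)) ^ α - rateMoment π α r - d k| ≤ 3 * (1 / ((j : ℝ) + 1)) := by
    intro j
    have hε : 0 < 1 / ((j : ℝ) + 1) := Nat.one_div_pos_of_nat
    obtain ⟨F, p, K, hp, hp0, hpK, happ⟩ := hr.exists_rpow_approx hG.nonneg hG.bounded hα0 hα1 hε
    obtain ⟨κ, _, hκ, herg⟩ := hG.ergodic F
    have hF : Measurable fun (x : Link → S) (b : F) => x b :=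
      measurable_pi_lambda _ fun b => measurable_pi_apply _
    have : IsProbabilityMeasure (π.map fun (x : Link → S) (b : F) => x b) :=
      Measure.isProbabilityMeasure_map hF.aemeasurable
    have hmean : |rateMoment π α r - ∫ y, p y ∂(π.map fun (x : Link → S) (b : F) => x b)|
        ≤ 1 / ((j : ℝ) + 1) := by
      have hpint : Integrable (fun x : Link → S => p fun b : F => x b) π :=
        Integrable.of_bound (hp.comp hF).aestronglyMeasurable K
          (Eventually.of_forall fun x => by rw [Real.norm_of_nonneg (hp0 _)]; exact hpK _)
      have hfint : Integrable (fun x : Link → S => (r fun b => (x b : ℝ)) ^ α) π := by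
        refine Integrable.of_bound hmeas.aestronglyMeasurable (1 / ((j : ℝ) + 1) + K)
          (Eventually.of_forall fun x => ?_)
        have h1 := happ x
        have h2 := abs_sub_abs_le_abs_sub ((r fun b => (x b : ℝ)) ^ α) (p fun b : F => x b)
        rw [abs_of_nonneg (hp0 _)] at h2
        rw [Real.norm_eq_abs]
        linarith [hpK fun b : F => x b]
      rw [rateMoment, integral_map hF.aemeasurable hp.aestronglyMeasurable,
        ← integral_sub hfint hpint]
      simpa using norm_integral_le_of_norm_le_const (μ := π)
        (f := fun x : Link → S => (r fun b => (x b : ℝ)) ^ α - p fun b : F => x b)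
        (Eventually.of_forall happ)
    filter_upwards [hκ.ae_exists_noise (fun k => hF.comp (hG.measurable k)) herg hp hp0 hpK hbsq hε]
      with ω ⟨d, hd, hdε⟩
    refine ⟨d, hd, hdε.mono fun k hk => ?_⟩
    have h1 := happ (G k ω)
    rw [abs_le] at *
    constructor <;> linarith [h1.1, h1.2, hk.1, hk.2, hmean.1, hmean.2]
  filter_upwards [ae_all_iff.2 hnoise] with ω hω
  refine tendsto_of_recursion hb0 hbsum (tendsto_zero_of_summable_sq hbsq) (fun k => rfl) ?_
  intro ε hε
  obtain ⟨j, hj⟩ := exists_nat_one_div_lt (show (0 : ℝ) < ε / 3 by positivity)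
  obtain ⟨d, hd, hdε⟩ := hω j
  exact ⟨d, hd, hdε.mono fun k hk => hk.trans (by linarith)⟩

lemma measurable_stepWeight {Ω X : Type*} [MeasurableSpace Ω] {a : ℕ → ℝ} {s : Ω → ℕ → X} {x : X}
    (hs : ∀ k, MeasurableSet {ω | s ω k = x}) (k : ℕ) :
    Measurable fun ω => stepWeight a (s ω) x k := by
  classical
  have hv : Measurable fun ω => visits (s ω) x k := by
    simp only [visits, Finset.card_filter]
    exact Finset.measurable_fun_sum _ fun i _ => Measurable.ite (hs i) measurable_const measurable_const
  exact ((measurable_of_countable a).comp hv).mul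
    (Measurable.ite (hs k) measurable_const measurable_const)

lemma measurable_recursiveAverage {Ω : Type*} [MeasurableSpace Ω] {b u : Ω → ℕ → ℝ}
    (hb : ∀ k, Measurable fun ω => b ω k) (hu : ∀ k, Measurable fun ω => u ω k) (k : ℕ) :
    Measurable fun ω => recursiveAverage (b ω) (u ω) k := by
  induction k with
  | zero => exact measurable_const
  | succ k ih => exact ih.add ((hb k).mul ((hu k).sub ih))

/-- Since the arrivals are independent of the fading, the path of states can be frozen, so that the step
sizes become deterministic. -/
lemma ae_tendsto_recursiveAverage_statePath {Ω Link : Type*} [MeasurableSpace Ω]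
    {P : Measure Ω} [IsProbabilityMeasure P] {A : ℕ → Ω → Fin n → ℕ} (hA : ∀ k, Measurable (A k))
    {S : Set ℝ} {G : ℕ → Ω → Link → S} {π : Measure (Link → S)} [IsProbabilityMeasure π]
    (hG : IsErgodicFading P S G π) (hAG : IndepFun (fun ω k => A k ω) (fun ω k => G k ω) P)
    {r : (Link → ℝ) → ℝ} (hr : IsRateFunction r) {α : ℝ} (hα0 : 0 < α) (hα1 : α ≤ 1)
    {a : ℕ → ℝ} (ha_pos : ∀ t, 1 ≤ t → 0 < a t) (ha_sum : ¬ Summable fun t : ℕ => a (t + 1))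
    (ha_sq : Summable fun t : ℕ => a (t + 1) ^ 2) (s₀ x : CellState l) :
    ∀ᵐ ω ∂P, (∃ᶠ k in atTop, statePath s₀ (fun k => A k ω) k = x) →
      Tendsto (recursiveAverage (stepWeight a (statePath s₀ fun k => A k ω) x)
        fun k => (r fun i => (G k ω i : ℝ)) ^ α) atTop (𝓝 (rateMoment π α r)) := by
  have hAm : Measurable fun ω k => A k ω := measurable_pi_lambda _ hA
  have hGm : Measurable fun ω k => G k ω := measurable_pi_lambda _ hG.measurable
  have hmeas := hr.measurable_rpow hG.nonneg hG.bounded hα0 hα1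
  have hset : MeasurableSet {z : (ℕ → Fin n → ℕ) × (ℕ → Link → S) |
      Tendsto (recursiveAverage (stepWeight a (statePath s₀ z.1) x)
        fun k => (r fun i => (z.2 k i : ℝ)) ^ α) atTop (𝓝 (rateMoment π α r))} := by
    refine measurableSet_tendsto _ fun k => measurable_recursiveAverage (fun k => ?_) (fun k => ?_) k
    · exact measurable_stepWeight (s := fun z : (ℕ → Fin n → ℕ) × (ℕ → Link → S) =>
        statePath s₀ z.1) (fun k => measurable_fst (measurableSet_statePath_eq s₀ x k)) k
    · exact hmeas.comp ((measurable_pi_apply k).comp measurable_snd)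
  have hfreq : MeasurableSet {z : (ℕ → Fin n → ℕ) × (ℕ → Link → S) |
      ∃ᶠ k in atTop, statePath s₀ z.1 k = x} := by
    have h := MeasurableSet.measurableSet_limsup fun k =>
      measurable_fst (β := ℕ → Link → S) (measurableSet_statePath_eq s₀ x k)
    convert h using 1
    ext z
    rw [mem_limsup_iff_frequently_mem]
    rfl
  have hset' := hfreq.imp hset
  have hlaw := hAG.map_prod_eq_prod_map_map hAm.aemeasurable hGm.aemeasurable
  refine (ae_map_iff (hAm.prodMk hGm).aemeasurable hset').1 ?_
  have := Measure.isProbabilityMeasure_map (μ := P) hGm.aemeasurable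
  rw [hlaw, Measure.ae_prod_iff_ae_ae hset']
  refine Eventually.of_forall fun A' => ?_
  refine (ae_map_iff hGm.aemeasurable (measurable_prodMk_left hset')).2 ?_
  by_cases hA' : ∃ᶠ k in atTop, statePath s₀ A' k = x
  · filter_upwards [hG.ae_tendsto_recursiveAverage hr hα0 hα1
      (stepWeight_nonneg ha_pos (statePath s₀ A') x) (not_summable_stepWeight ha_pos ha_sum hA')
      (summable_stepWeight_sq ha_sq _ x)] with ω hω _ using hω
  · exact Eventually.of_forall fun ω h => absurd h hA'

/-- Convergence of the estimates of one class of users. The initial state is an arbitrary function of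
the outcome, possibly not measurable, but it takes countably many values. -/
lemma ae_tendsto_estimate {Ω Link : Type*} [MeasurableSpace Ω]
    {P : Measure Ω} [IsProbabilityMeasure P] {A : ℕ → Ω → Fin n → ℕ} (hA : ∀ k, Measurable (A k))
    (hindep : iIndepFun A P) (hident : ∀ k, IdentDistrib (A k) (A 0) P P)
    {s : ℕ → Ω → CellState l} (hs : ∀ k ω, s (k + 1) ω = (s k ω).next (A k ω))
    {S : Set ℝ} {G : ℕ → Ω → Link → S} {π : Measure (Link → S)} [IsProbabilityMeasure π]
    (hG : IsErgodicFading P S G π) (hAG : IndepFun (fun ω k => A k ω) (fun ω k => G k ω) P)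
    {rate : CellState l → (Link → ℝ) → ℝ} (hrate : ∀ x, IsRateFunction (rate x))
    {α : ℝ} (hα0 : 0 < α) (hα1 : α ≤ 1)
    {a : ℕ → ℝ} (ha_pos : ∀ t, 1 ≤ t → 0 < a t) (ha_sum : ¬ Summable fun t : ℕ => a (t + 1))
    (ha_sq : Summable fun t : ℕ => a (t + 1) ^ 2)
    {g : PMF (CellState l)} (hg : IsSteadyState P (A 0) g) {x : CellState l} (hx : g x ≠ 0)
    {Y : ℕ → Ω → ℝ} (hY : ∀ k ω, Y (k + 1) ω = Y k ω + stepWeight a (fun k => s k ω) x k *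
      ((rate (s k ω) fun b => (G k ω b : ℝ)) ^ α - Y k ω)) :
    ∀ᵐ ω ∂P, Tendsto (fun k => Y k ω) atTop (𝓝 (rateMoment π α (rate x))) := by
  have hall := ae_all_iff.2 fun s₀ : CellState l =>
    ae_tendsto_recursiveAverage_statePath hA hG hAG (hrate x) hα0 hα1 ha_pos ha_sum ha_sq s₀ x
  filter_upwards [hall, ae_frequently_statePath_eq hA hindep hident hg hx] with ω h1 h2
  have hpath : (fun k => s k ω) = statePath (s 0 ω) fun k => A k ω := by
    funext k
    induction k with
    | zero => rfl
    | succ k ih => rw [hs, show s k ω = _ from ih, statePath]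
  have hsq := summable_stepWeight_sq ha_sq (statePath (s 0 ω) fun k => A k ω) x
  refine tendsto_of_tendsto_recursiveAverage (stepWeight_nonneg ha_pos _ x)
    (not_summable_stepWeight ha_pos ha_sum (h2 (s 0 ω))) (tendsto_zero_of_summable_sq hsq)
    (fun k => ?_) (h1 (s 0 ω) (h2 (s 0 ω)))
  rw [hY, hpath]
  -- The sample only enters when the current state is `x`.
  by_cases hk : s k ω = x
  · rw [hk]
  · have h0 : stepWeight a (statePath (s 0 ω) fun k => A k ω) x k = 0 := by
      rw [← hpath]; simp [stepWeight, hk]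
    simp [h0]

end AlphaFair

theorem theorem5
    {Ω : Type*} [MeasurableSpace Ω] (P : Measure Ω) [IsProbabilityMeasure P]
    -- the line segments of the cell, their lengths in slots, and the arrivals along them
    {n : ℕ} (l : Fin n → ℕ+)
    (A : ℕ → Ω → Fin n → ℕ) (hAmeas : ∀ k, Measurable (A k))
    (hAindep : iIndepFun A P) (hAident : ∀ k, IdentDistrib (A k) (A 0) P P)
    (hAbdd : ∃ C : ℕ, ∀ k i, ∀ᵐ ω ∂P, A k ω i ≤ C)
    -- the state process, from an arbitrary initial state
    (s : ℕ → Ω → AlphaFair.CellState l)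
    (hs : ∀ k ω, s (k + 1) ω = (s k ω).next (A k ω))
    -- fading, independent of the arrivals
    {BS Loc : Type*} (S : Set ℝ) (G : ℕ → Ω → BS × Loc → S)
    (π : Measure (BS × Loc → S)) [IsProbabilityMeasure π]
    (hG : AlphaFair.IsErgodicFading P S G π)
    (hAG : IndepFun (fun ω k => A k ω) (fun ω k => G k ω) P)
    -- the rates of the two classes per unit bandwidth, given the state and the gains
    (rateMobile rateStatic : AlphaFair.CellState l → (BS × Loc → ℝ) → ℝ)
    (hMobile : ∀ x, AlphaFair.IsRateFunction (rateMobile x))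
    (hStatic : ∀ x, AlphaFair.IsRateFunction (rateStatic x))
    -- the parameters and the step sizes
    (α ξ : ℝ) (hα0 : 0 < α) (hα1 : α < 1) (hξ : 0 < ξ)
    (a : ℕ → ℝ) (ha_pos : ∀ t, 1 ≤ t → 0 < a t) (ha_anti : AntitoneOn a (Set.Ici 1))
    (ha_sum : ¬ Summable fun t : ℕ => a (t + 1))
    (ha_sq : Summable fun t : ℕ => a (t + 1) ^ 2)
    -- the estimates and allocations produced by the learning algorithm
    (M Q : ℕ → AlphaFair.CellState l → Ω → ℝ) (η : ℕ → Ω → ℝ)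
    (hrun : ∀ ω, AlphaFair.IsRun α ξ a (fun k => s k ω)
      (fun k => (rateMobile (s k ω) fun b => (G k ω b : ℝ)) ^ α)
      (fun k => (rateStatic (s k ω) fun b => (G k ω b : ℝ)) ^ α)
      (fun k x => M k x ω) (fun k x => Q k x ω) (fun k => η k ω))
    -- the states of the cell are those with positive steady-state probability
    (g : PMF (AlphaFair.CellState l)) (hg : AlphaFair.IsSteadyState P (A 0) g) :
    ∀ x : AlphaFair.CellState l, 0 < g x →
      ∀ᵐ ω ∂P,
        Tendsto (fun k => M k x ω) atTop
          (𝓝 (AlphaFair.rateMoment π α (rateMobile x))) ∧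
        Tendsto (fun k => Q k x ω) atTop
          (𝓝 (AlphaFair.rateMoment π α (rateStatic x))) := by
  intro x hx
  have hM := AlphaFair.ae_tendsto_estimate (Y := fun k ω => M k x ω) hAmeas hAindep hAident hs hG hAG
    hMobile hα0 hα1.le ha_pos ha_sum ha_sq hg hx.ne' fun k ω => (hrun ω).updateM k x
  have hQ := AlphaFair.ae_tendsto_estimate (Y := fun k ω => Q k x ω) hAmeas hAindep hAident hs hG hAG
    hStatic hα0 hα1.le ha_pos ha_sum ha_sq hg hx.ne' fun k ω => (hrun ω).updateQ k x
  filter_upwards [hM, hQ] with ω h1 h2 using ⟨h1, h2⟩
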